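/- Conventions. A map is proper if it is continuous and preimages of compact sets are compact. For a self-map $S:Z\to Z$ of a locally compact metrizable (or compact) space $Z$, an admissible cover of $Z$ is a finite open cover each of whose members has compact closure or compact complement; for such a cover $\alpha$ let $\alpha^n$ be the cover by the sets $A_0\cap S^{-1}(A_1)\cap\dots\cap S^{-(n-1)}(A_{n-1})$ with $A_i\in\alpha$, let $N(\alpha^n)$ be the smallest cardinality of a subcover of $\alpha^n$, and put $$h(S)=\sup_{\alpha}\ \lim_{n\to\infty}\tfrac1n\log N(\alpha^n)\in[0,\infty],$$ the supremum being over all admissible covers $\alpha$ of $Z$ (for compact $Z$ this is the usual topological entropy). For a distance $d$ on $Z$ and $K\subset Z$, put $$h_d(S,K)=\lim_{\varepsilon\to0}\limsup_{n\to\infty}\tfrac1n\log r_n(\varepsilon,K),$$ where $r_n(\varepsilon,K)$ is the smallest cardinality of a set $E\subset Z$ such that for every $x\in K$ there is $y\in E$ with $d(S^kx,S^ky)<\varepsilon$ for all $0\le k<n$. (With $\log 0=-\infty$, both entropies are $-\infty$ on the empty set.) Proposition. Let $X$ and $Y$ be locally compact metrizable topological spaces, and let $\pi:X\to Y$, $\phi:X\to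 X$ and $\varphi:Y\to Y$ be continuous proper maps with $\pi\circ\phi=\varphi\circ\pi$. (1) For every distance $d_X$ on $X$ which is the restriction to $X$ of a distance inducing the topology of the one-point compactification of $X$, $$h(\phi)\le h(\varphi)+\sup_{y\in Y}h_{d_X}\bigl(\phi,\pi^{-1}(y)\bigr).$$ (2) Suppose moreover that $\pi:X\to Y$ is a principal bundle whose structure group is a compact group $T$: that is, $T$ acts continuously and freely on the right of $X$, the map $\pi$ identifies $Y$ with the orbit space $X/T$, and the map sending a pair $(x,xt)$ to $t$ is continuous (this includes all locally trivial principal $T$-bundles). If $\tau:T\to T$ is a map such that $\phi(xt)=\phi(x)\tau(t)$ for all $x\in X$ and $t\in T$, then $$h(\phi)\le h(\varphi)+h(\tau).$$ -/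

import Mathlib

open Set Filter Topology
open scoped RightActions

namespace LocallyCompactEntropy

noncomputable section

/-- An admissible cover of `X`: a finite open cover each of whose members has compact closure or
compact complement. On a compact Hausdorff space these are exactly the finite open covers. -/
structure IsAdmissibleCover {X : Type*} [TopologicalSpace X] (α : Set (Set X)) : Prop where
  finite : α.Finite
  isOpen : ∀ A ∈ α, IsOpen A
  compact : ∀ A ∈ α, IsCompact (closure A) ∨ IsCompact Aᶜ
  covers : ⋃₀ α = univ

/-- The iterated cover `αⁿ`, whose members are the sets
`A₀ ∩ T⁻¹(A₁) ∩ ⋯ ∩ T⁻⁽ⁿ⁻¹⁾(Aₙ₋₁)` with all `Aᵢ ∈ α`. -/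
def iterCover {X : Type*} (T : X → X) (α : Set (Set X)) (n : ℕ) : Set (Set X) :=
  {B | ∃ A : Fin n → Set X, (∀ i, A i ∈ α) ∧ B = ⋂ i : Fin n, T^[(i : ℕ)] ⁻¹' A i}

/-- `N(α)`: the smallest cardinality of a subcover of `α` (`⊤` if there is no finite one). -/
def minSubcover {X : Type*} (α : Set (Set X)) : ℕ∞ :=
  ⨅ (s : Finset (Set X)) (_ : (s : Set (Set X)) ⊆ α ∧ ⋃₀ (s : Set (Set X)) = univ), (s.card : ℕ∞)

/-- `h(T, α) = lim (1/n) log N(αⁿ)`. It is written with a `limsup`; for a finite cover `α` the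
sequence `log N(αⁿ)` is finite and subadditive when `X` is nonempty, so the limit exists. -/
def coverEntropy {X : Type*} (T : X → X) (α : Set (Set X)) : EReal :=
  limsup (fun n : ℕ ↦ ENNReal.log (minSubcover (iterCover T α n) : ENNReal) / (n : EReal)) atTop

/-- The topological entropy `h(T)` of a self-map of a locally compact space: the supremum of
`h(T, α)` over all admissible covers `α`. On a compact space this is the classical
Adler–Konheim–McAndrew entropy. The value is in `[0, +∞]`, except that it is `-∞` when `X` is
empty. -/
def topEntropy {X : Type*} [TopologicalSpace X] (T : X → X) : EReal :=
  ⨆ (α : Set (Set X)) (_ : IsAdmissibleCover α), coverEntropy T α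

/-- Bowen's entropy `h_d(T, K) = lim_{ε → 0} limsup_n (1/n) log r_n(ε, K)` of `T` on the subset
`K` with respect to the distance `d`, where `r_n(ε, K)` is the smallest cardinality of an
`(n, ε)`-spanning set of `K`: this is Mathlib's `Dynamics.coverEntropy` for the uniformity of `d`
(see `metricEntropy_eq`). -/
def metricEntropy {X : Type*} (d : MetricSpace X) (T : X → X) (K : Set X) : EReal :=
  letI := d
  Dynamics.coverEntropy T K

/-- The formula for `h_d(T, K)` in terms of spanning sets. -/
theorem metricEntropy_eq {X : Type*} (d : MetricSpace X) (T : X → X) (K : Set X) :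
    metricEntropy d T K =
      ⨆ (ε : ℝ) (_ : 0 < ε), limsup (fun n : ℕ ↦ ENNReal.log
        ((⨅ (s : Finset X) (_ : ∀ x ∈ K, ∃ y ∈ s, ∀ k < n, dist (T^[k] x) (T^[k] y) < ε),
          (s.card : ℕ∞) : ℕ∞) : ENNReal) / (n : EReal)) atTop := by
  unfold metricEntropy
  rw [Dynamics.coverEntropy_eq_iSup_basis Metric.uniformity_basis_dist]
  have key (ε : ℝ) (n : ℕ) :
      Dynamics.coverMincard T K {p : X × X | dist p.1 p.2 < ε} n =
      ⨅ (s : Finset X) (_ : ∀ x ∈ K, ∃ y ∈ s, ∀ k < n, dist (T^[k] x) (T^[k] y) < ε),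
          (s.card : ℕ∞) := by
    unfold Dynamics.coverMincard
    refine iInf_congr fun s ↦ iInf_congr_Prop ?_ fun _ ↦ rfl
    simp [Dynamics.IsDynCoverOf, SetRel.IsCover, Dynamics.mem_dynEntourage]
  simp only [Dynamics.coverEntropyEntourage, ExpGrowth.expGrowthSup, key]

/-- The distance on `X` induced by a distance on its one-point compactification. -/
@[reducible] def inducedDist {X : Type*} (d : MetricSpace (OnePoint X)) : MetricSpace X :=
  MetricSpace.induced ((↑) : X → OnePoint X) OnePoint.coe_injective d

/-- `π : X → Y` is a principal bundle with structure group `G` acting on the right of `X`: the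
action is continuous and free, the map `π` identifies `Y` with the orbit space `X / G`, and the
translation function `(x, x') ↦ g`, defined by `x' = x g` on pairs of points of the same orbit,
is continuous. In particular every locally trivial principal bundle is one. -/
structure IsPrincipalBundle {X Y : Type*} [TopologicalSpace X] [TopologicalSpace Y]
    (G : Type*) [Group G] [TopologicalSpace G] [MulAction Gᵐᵒᵖ X] (π : X → Y) : Prop where
  continuous_action : Continuous fun p : X × G ↦ p.1 <• p.2
  free : ∀ (x : X) (g : G), x <• g = x → g = 1
  isQuotientMap : IsQuotientMap π
  fibre_eq_orbit : ∀ x x' : X, π x = π x' ↔ ∃ g : G, x' = x <• g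
  continuous_translation : ∃ θ : {p : X × X // π p.1 = π p.2} → G,
    Continuous θ ∧ ∀ p, p.1.2 = p.1.1 <• θ p

end

end LocallyCompactEntropy

/-! Everything is transported to one-point compactifications. Admissible covers of `X` are traces of
open covers of `OnePoint X`, so `h(φ)` is at most the entropy of `OnePoint.map φ`; conversely small
open covers of `OnePoint Y` leave admissible traces, so the entropy of `OnePoint.map ϕ` is at most
`h(ϕ)`. Properness makes the extended maps continuous, and the only new fibre is the fixed point
`∞`, which adds no entropy.

What remains is Bowen's inequality over a compact base (`coverEntropy_le_add_iSup_fibre`). If all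
fibre entropies are below `a`, each fibre is spanned for some time `m` by at most `exp(a m)` points,
and by closedness of the projection so are the nearby fibres. By compactness finitely many such
times suffice; concatenating these blocks along a base orbit costs `exp(a(n + M))`, with `M` the
longest block.

For a principal bundle the fibres are orbits `xT`, and `φ^k(xt) = φ^k(x) τ^k(t)`. Since `T` is
compact, elements near `1` move all points of `X` uniformly little, so spanning sets of `T` give
spanning sets of `xT`. -/

namespace LocallyCompactEntropy

/-! ### Small open sets and Lebesgue entourages -/

section Uniform

open scoped Uniformity

theorem exists_isOpen_small {Z : Type*} [t : TopologicalSpace Z] (u : UniformSpace Z)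
    (hu : u.toTopologicalSpace = t) {V : Set (Z × Z)} (hV : V ∈ 𝓤 Z) (x : Z) :
    ∃ O, IsOpen O ∧ x ∈ O ∧ ∀ a ∈ O, ∀ b ∈ O, (a, b) ∈ V := by
  subst hu
  obtain ⟨D, hD, hsymm, hDV⟩ := comp_symm_mem_uniformity_sets hV
  refine ⟨interior (UniformSpace.ball x D), isOpen_interior,
    mem_interior_iff_mem_nhds.2 (UniformSpace.ball_mem_nhds x hD), fun a ha b hb ↦ hDV ?_⟩
  exact ⟨x, hsymm.symm _ _ (interior_subset (s := UniformSpace.ball x D) ha),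
    interior_subset (s := UniformSpace.ball x D) hb⟩

/-- The centre is the second coordinate, as in the spanning condition `isDynCoverOf_iff`. -/
theorem exists_symm_entourage_subset {Z ι : Type*} [t : TopologicalSpace Z] [CompactSpace Z]
    (u : UniformSpace Z) (hu : u.toTopologicalSpace = t) (c : ι → Set Z) (hc : ∀ i, IsOpen (c i))
    (hcov : ∀ x, ∃ i, x ∈ c i) :
    ∃ V ∈ 𝓤 Z, ∀ x, ∃ i, ∀ y, (y, x) ∈ V → y ∈ c i := by
  subst hu
  obtain ⟨V, hV, h⟩ := lebesgue_number_lemma isCompact_univ hc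
    (fun x _ ↦ mem_iUnion.2 (hcov x))
  refine ⟨Prod.swap ⁻¹' V, symm_le_uniformity hV, fun x ↦ ?_⟩
  obtain ⟨i, hi⟩ := h x trivial
  exact ⟨i, fun y hy ↦ hi hy⟩

end Uniform

/-! ### Bounds on spanning sets -/

section DynCover

variable {Z : Type*} {f : Z → Z} {F s : Set Z} {V : Set (Z × Z)} {n : ℕ}

theorem isDynCoverOf_iff : Dynamics.IsDynCoverOf f F V n s ↔
    ∀ x ∈ F, ∃ y ∈ s, ∀ k < n, (f^[k] x, f^[k] y) ∈ V := by
  simp [Dynamics.IsDynCoverOf, SetRel.IsCover, Dynamics.mem_dynEntourage]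

theorem coverMincard_le_of_forall_small (Q : Finset (Set Z)) (hcov : ∀ z ∈ F, ∃ S ∈ Q, z ∈ S)
    (hsmall : ∀ S ∈ Q, ∀ a ∈ S, ∀ b ∈ S, ∀ k < n, (f^[k] a, f^[k] b) ∈ V) :
    Dynamics.coverMincard f F V n ≤ Q.card := by
  classical
  have h (S : Set Z) : ∃ t : Finset Z, t.card ≤ 1 ∧ (S.Nonempty → ∃ y ∈ t, y ∈ S) := by
    rcases S.eq_empty_or_nonempty with rfl | ⟨y, hy⟩
    · exact ⟨∅, by simp, by simp⟩
    · exact ⟨{y}, by simp, fun _ ↦ ⟨y, by simp, hy⟩⟩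
  choose t ht₁ ht using h
  have hcover : Dynamics.IsDynCoverOf f F V n (Q.biUnion t : Finset Z) := by
    refine isDynCoverOf_iff.2 fun x hx ↦ ?_
    obtain ⟨S, hS, hxS⟩ := hcov x hx
    obtain ⟨y, hy, hyS⟩ := ht S ⟨x, hxS⟩
    exact ⟨y, by simpa using ⟨S, hS, hy⟩, hsmall S hS x hxS y hyS⟩
  have := Finset.card_biUnion_le_card_mul Q t 1 fun S _ ↦ ht₁ S
  rw [mul_one] at this
  exact hcover.coverMincard_le_card.trans (by exact_mod_cast this)

theorem coverEntropy_singleton_le [UniformSpace Z] {x : Z} (hx : f x = x) :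
    Dynamics.coverEntropy f {x} ≤ 0 := by
  refine iSup₂_le fun U hU ↦ ?_
  rw [← ExpGrowth.expGrowthSup_const one_ne_zero ENNReal.one_ne_top]
  refine ExpGrowth.expGrowthSup_monotone fun n ↦ ?_
  have h := coverMincard_le_of_forall_small (f := f) (F := {x}) (V := U) (n := n) {{x}}
    (by simp) (by
      simp only [Finset.mem_singleton, forall_eq, mem_singleton_iff]
      exact fun k _ ↦ refl_mem_uniformity hU)
  simpa using ENat.toENNReal_mono h

end DynCover

/-! ### Concatenating orbit blocks -/

section Itinerary

/-- Induction on time, peeling off the block of length `m w` at `w` and continuing from `g^[m w] w`.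
The pieces are sets, not points: no single orbit need follow the concatenated centres. The last
block may overshoot `n`, whence the extra `M` in the exponent. -/
theorem exists_finset_itinerary_cover {Z W : Type*} (f : Z → Z) (g : W → W) (p : Z → W)
    (V : Set (Z × Z)) {b : ENNReal} (hb : 1 ≤ b) {M : ℕ} (m : W → ℕ) (E : W → Finset Z)
    (N : W → Set W) (hm : ∀ w, 1 ≤ m w) (hmM : ∀ w, m w ≤ M)
    (hE : ∀ w, ((E w).card : ENNReal) ≤ b ^ m w)
    (hN : ∀ w z, p z ∈ N w → ∃ e ∈ E w, ∀ k < m w, (f^[k] z, f^[k] e) ∈ V) (n : ℕ) :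
    ∀ w, ∃ Q : Finset (Set Z), (Q.card : ENNReal) ≤ b ^ (n + M) ∧
      (∀ z, (∀ k < n, p (f^[k] z) ∈ N (g^[k] w)) → ∃ S ∈ Q, z ∈ S) ∧
      ∀ S ∈ Q, ∀ x ∈ S, ∀ y ∈ S, ∀ k < n, ∃ c, (f^[k] x, c) ∈ V ∧ (f^[k] y, c) ∈ V := by
  classical
  induction n using Nat.strong_induction_on with
  | _ n ih =>
  intro w
  rcases Nat.eq_zero_or_pos n with rfl | hn
  · exact ⟨{univ}, by simpa using one_le_pow₀ hb, by simp, by simp⟩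
  let R (e : Z) : Set Z := {z | ∀ k < m w, (f^[k] z, f^[k] e) ∈ V}
  by_cases hnm : n ≤ m w
  · refine ⟨(E w).image R, ?_, fun z hz ↦ ?_, ?_⟩
    · calc (((E w).image R).card : ENNReal) ≤ (E w).card := by exact_mod_cast Finset.card_image_le
        _ ≤ b ^ m w := hE w
        _ ≤ b ^ (n + M) := pow_le_pow_right₀ hb ((hmM w).trans (by omega))
    · obtain ⟨e, he, h⟩ := hN w z (hz 0 hn)
      exact ⟨R e, Finset.mem_image_of_mem _ he, h⟩
    · simp only [Finset.forall_mem_image]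
      exact fun e _ x hx y hy k hk ↦ ⟨f^[k] e, hx k (hk.trans_le hnm), hy k (hk.trans_le hnm)⟩
  · push Not at hnm
    obtain ⟨Q, hQ, hcov, hsmall⟩ := ih (n - m w) (by have := hm w; omega) (g^[m w] w)
    refine ⟨Finset.image₂ (fun e S ↦ R e ∩ f^[m w] ⁻¹' S) (E w) Q, ?_, fun z hz ↦ ?_, ?_⟩
    · calc ((Finset.image₂ (fun e S ↦ R e ∩ f^[m w] ⁻¹' S) (E w) Q).card : ENNReal)
          ≤ (E w).card * Q.card := by
            exact_mod_cast Finset.card_image₂_le (fun e S ↦ R e ∩ f^[m w] ⁻¹' S) (E w) Q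
        _ ≤ b ^ m w * b ^ (n - m w + M) := mul_le_mul' (hE w) hQ
        _ = b ^ (n + M) := by rw [← pow_add]; congr 1; omega
    · obtain ⟨e, he, h⟩ := hN w z (hz 0 hn)
      obtain ⟨S, hS, hzS⟩ := hcov (f^[m w] z) fun k hk ↦ by
        rw [← Function.iterate_add_apply, ← Function.iterate_add_apply]
        exact hz _ (by omega)
      exact ⟨_, Finset.mem_image₂_of_mem he hS, h, hzS⟩
    · simp only [Finset.forall_mem_image₂]
      intro e _ S hS x hx y hy k hk
      rcases lt_or_ge k (m w) with h | h
      · exact ⟨f^[k] e, hx.1 k h, hy.1 k h⟩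
      · have := hsmall S hS _ hx.2 _ hy.2 (k - m w) (by omega)
        rwa [← Function.iterate_add_apply, ← Function.iterate_add_apply,
          Nat.sub_add_cancel h] at this

end Itinerary

/-! ### Bowen's inequality over a compact base -/

section Bowen

open scoped Uniformity

theorem exists_finset_pow_card_of_coverEntropy_lt {Z : Type*} [UniformSpace Z] {f : Z → Z}
    {F : Set Z} {V : Set (Z × Z)} (hV : V ∈ 𝓤 Z) {a : EReal} (ha : a ≠ ⊤)
    (h : Dynamics.coverEntropy f F < a) :
    ∃ m ≥ 1, ∃ E : Finset Z, (E.card : ENNReal) ≤ a.exp ^ m ∧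
      ∀ x ∈ F, ∃ y ∈ E, ∀ k < m, (f^[k] x, f^[k] y) ∈ V := by
  have hlt : ExpGrowth.expGrowthSup
      (fun n : ℕ ↦ (Dynamics.coverMincard f F V n : ENNReal)) < a :=
    (Dynamics.coverEntropyEntourage_le_coverEntropy f F hV).trans_lt h
  obtain ⟨m, hm, hm₁⟩ := ((ExpGrowth.eventually_le_exp hlt).and (eventually_ge_atTop 1)).exists
  rw [mul_comm, EReal.exp_nmul] at hm
  have hfin : (Dynamics.coverMincard f F V m : ENNReal) < ⊤ :=
    hm.trans_lt (ENNReal.pow_lt_top (by simpa [lt_top_iff_ne_top] using ha))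
  obtain ⟨E, hE, hcard⟩ := (Dynamics.coverMincard_finite_iff f F V m).1 (by simpa using hfin)
  refine ⟨m, hm₁, E, ?_, isDynCoverOf_iff.1 hE⟩
  rwa [← hcard] at hm

theorem coverEntropy_le_add_of_forall_fibre_lt {Z W : Type*} [tZ : TopologicalSpace Z]
    [tW : TopologicalSpace W] [CompactSpace W]
    (uZ : UniformSpace Z) (hZ : uZ.toTopologicalSpace = tZ)
    (uW : UniformSpace W) (hW : uW.toTopologicalSpace = tW)
    {f : Z → Z} {g : W → W} {p : Z → W} (hf : Continuous f) (hp : IsClosedMap p)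
    (hpfg : Function.Semiconj p f g) {a : EReal} (ha₀ : 0 ≤ a) (ha : a ≠ ⊤)
    (h : ∀ w, Dynamics.coverEntropy f (p ⁻¹' {w}) < a) :
    Dynamics.coverEntropy f univ ≤ Dynamics.coverEntropy g univ + a := by
  classical
  subst hZ
  refine iSup₂_le fun U hU ↦ ?_
  obtain ⟨V, hV, hVo, hVs, hVU⟩ := comp_open_symm_mem_uniformity_sets hU
  choose m hm E hE hcov using fun w ↦ exists_finset_pow_card_of_coverEntropy_lt hV ha (h w)
  let O (w : W) : Set Z := {z | ∃ e ∈ E w, ∀ k < m w, (f^[k] z, f^[k] e) ∈ V}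
  have hO (w : W) : IsOpen (O w) := by
    have : O w = ⋃ e ∈ E w, ⋂ k ∈ Finset.range (m w), (fun z ↦ (f^[k] z, f^[k] e)) ⁻¹' V := by
      ext z; simp [O]
    rw [this]
    refine isOpen_biUnion fun e _ ↦ isOpen_biInter_finset fun k _ ↦ hVo.preimage ?_
    have := hf.iterate k
    fun_prop
  -- Tube argument: the base points whose whole fibre lies in `O w`; this set is open because `p` is
  -- closed.
  let N (w : W) : Set W := (p '' (O w)ᶜ)ᶜ
  have hNo (w : W) : IsOpen (N w) := (hp _ (hO w).isClosed_compl).isOpen_compl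
  have hN (w : W) : w ∈ N w := by
    rintro ⟨z, hz, rfl⟩
    exact hz (hcov _ z rfl)
  have hNO (w : W) (z : Z) (hz : p z ∈ N w) : z ∈ O w := by
    by_contra hzO
    exact hz ⟨z, hzO, rfl⟩
  obtain ⟨t, ht⟩ := isCompact_univ.elim_finite_subcover N hNo
    (fun w _ ↦ mem_iUnion.2 ⟨w, hN w⟩)
  obtain ⟨D, hD, hDN⟩ := exists_symm_entourage_subset uW hW (fun i : t ↦ N i) (fun i ↦ hNo i)
    (fun w ↦ by simpa using ht (mem_univ w))
  choose c hc using hDN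
  let M := t.sup m
  have hb : 1 ≤ a.exp := by simpa using EReal.exp_monotone ha₀
  have hQ (n : ℕ) := exists_finset_itinerary_cover f g p V hb (M := M) (fun w ↦ m (c w))
    (fun w ↦ E (c w)) (fun w ↦ N (c w)) (fun w ↦ hm _) (fun w ↦ Finset.le_sup (c w).2)
    (fun w ↦ hE _) (fun w ↦ hNO _) n
  have hcount (n : ℕ) : (Dynamics.coverMincard f univ U n : ENNReal) ≤
      a.exp ^ M * (Dynamics.coverMincard g univ D n * a.exp ^ n) := by
    rcases eq_top_or_lt_top (Dynamics.coverMincard g univ D n) with htop | hfin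
    · have h₀ : a.exp ≠ 0 := (zero_lt_one.trans_le hb).ne'
      simp [htop, h₀]
    obtain ⟨F, hF, hFcard⟩ := (Dynamics.coverMincard_finite_iff g univ D n).1 hfin
    choose Q hQcard hQcov hQsmall using hQ n
    have key := coverMincard_le_of_forall_small (f := f) (F := univ) (V := U) (n := n)
      (F.biUnion Q) (fun z _ ↦ by
        obtain ⟨w, hw, hzw⟩ := isDynCoverOf_iff.1 hF (p z) trivial
        obtain ⟨S, hS, hzS⟩ := hQcov w z fun k hk ↦ by
          rw [(hpfg.iterate_right k).eq]
          exact hc _ _ (hzw k hk)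
        exact ⟨S, Finset.mem_biUnion.2 ⟨w, hw, hS⟩, hzS⟩) (fun S hS x hx y hy k hk ↦ by
        obtain ⟨w, _, hSw⟩ := Finset.mem_biUnion.1 hS
        obtain ⟨e, hxe, hye⟩ := hQsmall w S hSw x hx y hy k hk
        exact hVU ⟨e, hxe, hVs.symm _ _ hye⟩)
    calc (Dynamics.coverMincard f univ U n : ENNReal)
        ≤ (F.biUnion Q).card := by simpa using ENat.toENNReal_mono key
      _ ≤ ∑ w ∈ F, ((Q w).card : ENNReal) := by exact_mod_cast Finset.card_biUnion_le
      _ ≤ ∑ w ∈ F, a.exp ^ (n + M) := Finset.sum_le_sum fun w _ ↦ hQcard w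
      _ = a.exp ^ M * (Dynamics.coverMincard g univ D n * a.exp ^ n) := by
        rw [Finset.sum_const, nsmul_eq_mul, ← hFcard, pow_add, ENat.toENNReal_coe]
        ring
  calc Dynamics.coverEntropyEntourage f univ U
      ≤ ExpGrowth.expGrowthSup (fun n : ℕ ↦
          (Dynamics.coverMincard g univ D n : ENNReal) * a.exp ^ n) :=
        ExpGrowth.expGrowthSup_le_of_eventually_le
          (ENNReal.pow_ne_top (by simpa using ha)) (Eventually.of_forall hcount)
    _ ≤ Dynamics.coverEntropyEntourage g univ D + ExpGrowth.expGrowthSup (fun n ↦ a.exp ^ n) := by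
        refine ExpGrowth.expGrowthSup_mul_le (.inr ?_) (.inr ?_) <;>
          rw [ExpGrowth.expGrowthSup_pow, EReal.log_exp]
        exacts [ha, (EReal.bot_lt_zero.trans_le ha₀).ne']
    _ ≤ Dynamics.coverEntropy g univ + a := by
        rw [ExpGrowth.expGrowthSup_pow, EReal.log_exp]
        gcongr
        exact Dynamics.coverEntropyEntourage_le_coverEntropy g univ hD

/-- Bowen's inequality for the entropy of an extension. -/
theorem coverEntropy_le_add_iSup_fibre {Z W : Type*} [tZ : TopologicalSpace Z]
    [tW : TopologicalSpace W] [CompactSpace W] [Nonempty Z]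
    (uZ : UniformSpace Z) (hZ : uZ.toTopologicalSpace = tZ)
    (uW : UniformSpace W) (hW : uW.toTopologicalSpace = tW)
    {f : Z → Z} {g : W → W} {p : Z → W} (hf : Continuous f) (hp : IsClosedMap p)
    (hpfg : Function.Semiconj p f g) :
    Dynamics.coverEntropy f univ ≤
      Dynamics.coverEntropy g univ + ⨆ w, Dynamics.coverEntropy f (p ⁻¹' {w}) := by
  obtain ⟨z⟩ := ‹Nonempty Z›
  have hg : 0 ≤ Dynamics.coverEntropy g univ := Dynamics.coverEntropy_nonneg g ⟨p z, trivial⟩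
  have hs : 0 ≤ ⨆ w, Dynamics.coverEntropy f (p ⁻¹' {w}) :=
    le_iSup_of_le (p z) (Dynamics.coverEntropy_nonneg f ⟨z, rfl⟩)
  refine EReal.le_add_of_forall_gt (.inl (EReal.bot_lt_zero.trans_le hg).ne')
    (.inr (EReal.bot_lt_zero.trans_le hs).ne') fun b hb a ha ↦ ?_
  -- For `a = ⊤` the bound is trivial once `⊥ + ⊤ = ⊥` is excluded.
  rcases eq_or_ne a ⊤ with rfl | ha'
  · rw [EReal.add_top_of_ne_bot (EReal.bot_lt_zero.trans (hg.trans_lt hb)).ne']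
    exact le_top
  · exact (coverEntropy_le_add_of_forall_fibre_lt uZ hZ uW hW hf hp hpfg (hs.trans ha.le) ha'
      fun w ↦ (le_iSup (fun w ↦ Dynamics.coverEntropy f (p ⁻¹' {w})) w).trans_lt ha).trans
      (by gcongr)

end Bowen

/-! ### Admissible covers and the one-point compactification -/

section AdmissibleCovers

open scoped Uniformity

theorem minSubcover_le_card {X : Type*} {α : Set (Set X)} (s : Finset (Set X))
    (hs : (s : Set (Set X)) ⊆ α) (hcov : ∀ x, ∃ A ∈ s, x ∈ A) : minSubcover α ≤ s.card :=
  iInf₂_le s ⟨hs, eq_univ_of_forall fun x ↦ by simpa using hcov x⟩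

theorem coverMincard_le_minSubcover {Z : Type*} {S : Z → Z} {V : Set (Z × Z)} {α : Set (Set Z)}
    (hα : ∀ A ∈ α, ∀ a ∈ A, ∀ b ∈ A, (a, b) ∈ V) (n : ℕ) :
    Dynamics.coverMincard S univ V n ≤ minSubcover (iterCover S α n) := by
  refine le_iInf₂ fun Q hQ ↦ coverMincard_le_of_forall_small Q (fun z _ ↦ ?_) ?_
  · simpa using hQ.2.ge (mem_univ z)
  · intro B hB a ha b hb k hk
    obtain ⟨A, hA, rfl⟩ := hQ.1 hB
    exact hα _ (hA ⟨k, hk⟩) _ (mem_iInter.1 ha ⟨k, hk⟩) _ (mem_iInter.1 hb ⟨k, hk⟩)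

/-- Only the existence of small admissible covers links `u` to the topology, so this serves both `Y`
with the uniformity induced from `OnePoint Y` and the compact group `T`. -/
theorem coverEntropy_le_topEntropy {Z : Type*} [TopologicalSpace Z] (u : UniformSpace Z)
    (S : Z → Z) (h : ∀ V ∈ 𝓤 Z, ∃ α : Set (Set Z), IsAdmissibleCover α ∧
      ∀ A ∈ α, ∀ a ∈ A, ∀ b ∈ A, (a, b) ∈ V) :
    Dynamics.coverEntropy S univ ≤ topEntropy S := by
  refine iSup₂_le fun V hV ↦ ?_
  obtain ⟨α, hα, hαV⟩ := h V hV
  refine le_iSup₂_of_le α hα (ExpGrowth.expGrowthSup_monotone fun n ↦ ?_)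
  exact ENat.toENNReal_mono (coverMincard_le_minSubcover hαV n)

theorem exists_isAdmissibleCover_small {Z : Type*} [t : TopologicalSpace Z] [CompactSpace Z]
    (u : UniformSpace Z) (hu : u.toTopologicalSpace = t) {V : Set (Z × Z)} (hV : V ∈ 𝓤 Z) :
    ∃ α : Set (Set Z), IsAdmissibleCover α ∧ ∀ A ∈ α, ∀ a ∈ A, ∀ b ∈ A, (a, b) ∈ V := by
  choose O hO hmem hsmall using exists_isOpen_small u hu hV
  obtain ⟨s, hs⟩ := isCompact_univ.elim_finite_subcover O hO
    (fun x _ ↦ mem_iUnion.2 ⟨x, hmem x⟩)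
  refine ⟨O '' s, ⟨s.finite_toSet.image O, ?_, ?_, ?_⟩, ?_⟩
  · rintro _ ⟨x, _, rfl⟩; exact hO x
  · rintro _ ⟨x, _, rfl⟩; exact .inl isClosed_closure.isCompact
  · exact eq_univ_of_forall fun x ↦ by simpa using hs (mem_univ x)
  · rintro _ ⟨x, _, rfl⟩; exact hsmall x

theorem exists_isAdmissibleCover_small_onePoint {Y : Type*} [TopologicalSpace Y] [T2Space Y]
    [LocallyCompactSpace Y] (u : UniformSpace (OnePoint Y))
    (hu : u.toTopologicalSpace = OnePoint.instTopologicalSpace)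
    {V : Set (OnePoint Y × OnePoint Y)} (hV : V ∈ 𝓤 (OnePoint Y)) :
    ∃ α : Set (Set Y), IsAdmissibleCover α ∧
      ∀ A ∈ α, ∀ a ∈ A, ∀ b ∈ A, ((a : OnePoint Y), (b : OnePoint Y)) ∈ V := by
  have key (x : OnePoint Y) : ∃ O : Set (OnePoint Y), IsOpen O ∧ x ∈ O ∧
      (∀ a ∈ O, ∀ b ∈ O, (a, b) ∈ V) ∧
      (IsCompact (closure ((↑) ⁻¹' O : Set Y)) ∨ IsCompact ((↑) ⁻¹' O : Set Y)ᶜ) := by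
    obtain ⟨O, hO, hx, hOV⟩ := exists_isOpen_small u hu hV x
    induction x using OnePoint.rec with
    | infty => exact ⟨O, hO, hx, hOV, .inr ((OnePoint.isOpen_iff_of_mem hx).1 hO).2⟩
    | coe x =>
      obtain ⟨K, hK, hxK⟩ := exists_compact_mem_nhds x
      refine ⟨O ∩ (↑) '' interior K, hO.inter (OnePoint.isOpen_image_coe.2 isOpen_interior),
        ⟨hx, mem_image_of_mem _ (mem_interior_iff_mem_nhds.2 hxK)⟩,
        fun a ha b hb ↦ hOV a ha.1 b hb.1, .inl ?_⟩
      refine hK.of_isClosed_subset isClosed_closure (closure_minimal ?_ hK.isClosed)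
      rw [preimage_inter, preimage_image_eq _ OnePoint.coe_injective]
      exact inter_subset_right.trans interior_subset
  choose O hO hmem hsmall hcpt using key
  obtain ⟨s, hs⟩ := isCompact_univ.elim_finite_subcover O hO
    (fun x _ ↦ mem_iUnion.2 ⟨x, hmem x⟩)
  refine ⟨(fun x ↦ (↑) ⁻¹' O x) '' s, ⟨s.finite_toSet.image _, ?_, ?_, ?_⟩, ?_⟩
  · rintro _ ⟨x, _, rfl⟩; exact (hO x).preimage OnePoint.continuous_coe
  · rintro _ ⟨x, _, rfl⟩; exact hcpt x
  · exact eq_univ_of_forall fun y ↦ by simpa using hs (mem_univ (y : OnePoint Y))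
  · rintro _ ⟨x, _, rfl⟩ a ha b hb; exact hsmall x _ ha _ hb

theorem coverEntropy_onePointMap_le_topEntropy {Y : Type*} [TopologicalSpace Y] [T2Space Y]
    [LocallyCompactSpace Y] [Nonempty Y] (u : UniformSpace (OnePoint Y))
    (hu : u.toTopologicalSpace = OnePoint.instTopologicalSpace) (ϕ : Y → Y) :
    Dynamics.coverEntropy (OnePoint.map ϕ) univ ≤ topEntropy ϕ := by
  have hsemi : Function.Semiconj ((↑) : Y → OnePoint Y) ϕ (OnePoint.map ϕ) := fun _ ↦ rfl
  have hcoe : Dynamics.coverEntropy (OnePoint.map ϕ) (range ((↑) : Y → OnePoint Y)) ≤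
      topEntropy ϕ := by
    rw [← image_univ, Dynamics.coverEntropy_image_of_comap u hsemi]
    refine coverEntropy_le_topEntropy _ ϕ fun V ⟨D, hD, hDV⟩ ↦ ?_
    obtain ⟨α, hα, h⟩ := exists_isAdmissibleCover_small_onePoint u hu hD
    exact ⟨α, hα, fun A hA a ha b hb ↦ hDV (h A hA a ha b hb)⟩
  rw [← OnePoint.range_coe_union_infty, Dynamics.coverEntropy_union]
  refine max_le hcoe ((coverEntropy_singleton_le rfl).trans ?_)
  exact (Dynamics.coverEntropy_nonneg _ (range_nonempty _)).trans hcoe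

theorem topEntropy_of_isEmpty {X : Type*} [TopologicalSpace X] [IsEmpty X] (φ : X → X) :
    topEntropy φ = ⊥ := by
  refine le_bot_iff.1 (iSup₂_le fun α _ ↦ ?_)
  rw [← ExpGrowth.expGrowthSup_zero]
  refine ExpGrowth.expGrowthSup_monotone fun n ↦ ?_
  simpa using minSubcover_le_card (α := iterCover φ α n) ∅ (by simp) isEmptyElim

theorem topEntropy_le_coverEntropy_onePointMap {X : Type*} [TopologicalSpace X]
    (u : UniformSpace (OnePoint X))
    (hu : u.toTopologicalSpace = OnePoint.instTopologicalSpace) (φ : X → X) :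
    topEntropy φ ≤ Dynamics.coverEntropy (OnePoint.map φ) univ := by
  classical
  rcases isEmpty_or_nonempty X with hX | ⟨⟨x₀⟩⟩
  · exact (topEntropy_of_isEmpty φ).trans_le bot_le
  refine iSup₂_le fun α hα ↦ ?_
  -- The largest open subset of `OnePoint X` with trace `A`.
  let c (A : α) : Set (OnePoint X) :=
    (↑) '' (A : Set X) ∪ {z | z = OnePoint.infty ∧ IsCompact (A : Set X)ᶜ}
  have hcpre (A : α) : ((↑) ⁻¹' c A : Set X) = A := by
    ext x; simp [c]
  have hc (A : α) : IsOpen (c A) := by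
    have hA := hα.isOpen A A.2
    by_cases hcpt : IsCompact (A : Set X)ᶜ
    · rw [OnePoint.isOpen_iff_of_mem (by simp [c, hcpt]), hcpre]
      exact ⟨hA.isClosed_compl, hcpt⟩
    · rwa [OnePoint.isOpen_iff_of_notMem (by simp [c, hcpt]), hcpre]
  have hmem (x : X) : ∃ A : α, x ∈ (A : Set X) := by
    simpa using hα.covers.ge (mem_univ x)
  have hcov (z : OnePoint X) : ∃ A, z ∈ c A := by
    induction z using OnePoint.rec with
    | coe x =>
      obtain ⟨A, hA⟩ := hmem x
      exact ⟨A, .inl (mem_image_of_mem _ hA)⟩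
    | infty =>
      -- Otherwise all members have compact closure, so `X` is compact and every closed complement
      -- is compact after all.
      suffices ∃ A : α, IsCompact (A : Set X)ᶜ from this.imp fun A hA ↦ .inr ⟨rfl, hA⟩
      by_contra! hno
      have huniv : IsCompact (univ : Set X) := by
        have := hα.finite.isCompact_biUnion (f := closure)
          fun A hA ↦ (hα.compact A hA).resolve_right (hno ⟨A, hA⟩)
        convert this
        refine (eq_univ_of_forall fun x ↦ ?_).symm
        obtain ⟨A, hA⟩ := hmem x
        exact mem_biUnion A.2 (subset_closure hA)
      obtain ⟨A, -⟩ := hmem x₀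
      exact hno A (huniv.of_isClosed_subset (hα.isOpen A A.2).isClosed_compl (subset_univ _))
  obtain ⟨V, hV, hVc⟩ := exists_symm_entourage_subset u hu c hc hcov
  choose A hA using hVc
  refine le_trans (ExpGrowth.expGrowthSup_monotone fun n ↦ ENat.toENNReal_mono ?_)
    (Dynamics.coverEntropyEntourage_le_coverEntropy _ _ hV)
  refine le_iInf₂ fun E hE ↦ ?_
  let B (z : OnePoint X) : Set X :=
    ⋂ k : Fin n, φ^[(k : ℕ)] ⁻¹' (A ((OnePoint.map φ)^[(k : ℕ)] z) : Set X)
  refine (minSubcover_le_card (E.image B) ?_ fun x ↦ ?_).trans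
    (by exact_mod_cast Finset.card_image_le)
  · intro S hS
    obtain ⟨z, -, rfl⟩ := Finset.mem_image.1 (Finset.mem_coe.1 hS)
    exact ⟨fun k ↦ A ((OnePoint.map φ)^[(k : ℕ)] z), fun k ↦ Subtype.prop _, rfl⟩
  · obtain ⟨z, hz, hxz⟩ := isDynCoverOf_iff.1 hE (x : OnePoint X) trivial
    refine ⟨B z, Finset.mem_image_of_mem B hz, mem_iInter.2 fun k ↦ ?_⟩
    have h := hA _ _ (hxz k k.2)
    have hsemi : Function.Semiconj ((↑) : X → OnePoint X) φ (OnePoint.map φ) := fun _ ↦ rfl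
    rw [← (hsemi.iterate_right k).eq, ← mem_preimage, hcpre] at h
    exact h

end AdmissibleCovers

/-! ### Proper extensions and compact group actions -/

section Extensions

open scoped Uniformity

theorem continuous_onePointMap {X Y : Type*} [TopologicalSpace X] [T2Space X] [TopologicalSpace Y]
    [T2Space Y] [LocallyCompactSpace Y] {f : X → Y} (hf : IsProperMap f) :
    Continuous (OnePoint.map f) := by
  refine OnePoint.continuous_map hf.continuous ?_
  rw [coclosedCompact_eq_cocompact, coclosedCompact_eq_cocompact]
  exact (isProperMap_iff_tendsto_cocompact.1 hf).2

theorem topEntropy_le_add_iSup_fibre {X Y : Type*}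
    [TopologicalSpace X] [T2Space X] [LocallyCompactSpace X]
    [TopologicalSpace Y] [T2Space Y] [LocallyCompactSpace Y]
    {π : X → Y} {φ : X → X} {ϕ : Y → Y} (hπ : IsProperMap π) (hφ : IsProperMap φ)
    (hcomm : Function.Semiconj π φ ϕ) (u : UniformSpace (OnePoint X))
    (hu : u.toTopologicalSpace = OnePoint.instTopologicalSpace) :
    topEntropy φ ≤ topEntropy ϕ +
      ⨆ y, @Dynamics.coverEntropy X (u.comap (↑)) φ (π ⁻¹' {y}) := by
  have hX := topEntropy_le_coverEntropy_onePointMap u hu φ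
  rcases isEmpty_or_nonempty X with hempty | ⟨⟨x₀⟩⟩
  · exact (topEntropy_of_isEmpty φ).trans_le bot_le
  have : Nonempty Y := ⟨π x₀⟩
  let v : UniformSpace (OnePoint Y) := uniformSpaceOfCompactR1
  have hclosed : IsClosedMap (OnePoint.map π) := (continuous_onePointMap hπ).isClosedMap
  have hsemi : Function.Semiconj (OnePoint.map π) (OnePoint.map φ) (OnePoint.map ϕ) := by
    intro z
    induction z using OnePoint.rec with
    | infty => rfl
    | coe x => exact congrArg _ (hcomm x)
  refine hX.trans ((coverEntropy_le_add_iSup_fibre u hu v rfl (continuous_onePointMap hφ) hclosed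
    hsemi).trans (add_le_add (coverEntropy_onePointMap_le_topEntropy v rfl ϕ) (iSup_le fun w ↦ ?_)))
  have hcoe : Function.Semiconj ((↑) : X → OnePoint X) φ (OnePoint.map φ) := fun _ ↦ rfl
  induction w using OnePoint.rec with
  | infty =>
    have hfib : OnePoint.map π ⁻¹' {OnePoint.infty} = {OnePoint.infty} := by
      ext z
      induction z using OnePoint.rec <;> simp
    rw [hfib]
    let uX : UniformSpace X := u.comap (↑)
    have hmap : OnePoint.map φ OnePoint.infty = OnePoint.infty := rfl
    -- A nonempty fibre makes the supremum nonnegative, which absorbs the fibre over `∞`.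
    have h₀ : 0 ≤ Dynamics.coverEntropy φ (π ⁻¹' {π x₀}) :=
      Dynamics.coverEntropy_nonneg φ ⟨x₀, rfl⟩
    exact (coverEntropy_singleton_le hmap).trans
      (h₀.trans (le_iSup (fun y ↦ Dynamics.coverEntropy φ (π ⁻¹' {y})) (π x₀)))
  | coe y =>
    have hfib : OnePoint.map π ⁻¹' {(y : OnePoint Y)} = (↑) '' (π ⁻¹' {y}) := by
      ext z
      induction z using OnePoint.rec <;> simp
    rw [hfib, Dynamics.coverEntropy_image_of_comap u hcoe]
    let uX : UniformSpace X := u.comap (↑)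
    exact le_iSup (fun y ↦ Dynamics.coverEntropy φ (π ⁻¹' {y})) y

/-- Compactness of `OnePoint X` reduces this to a local statement. At `∞`, outside the compact
saturation `K T` whole orbits avoid `K`, hence stay near `∞`. -/
theorem eventually_forall_smul_close {X T : Type*} [TopologicalSpace X] [T2Space X]
    [LocallyCompactSpace X] [Group T] [TopologicalSpace T] [CompactSpace T] [MulAction Tᵐᵒᵖ X]
    (hact : Continuous fun p : X × T ↦ p.1 <• p.2) (u : UniformSpace (OnePoint X))
    (hu : u.toTopologicalSpace = OnePoint.instTopologicalSpace)
    {U : Set (OnePoint X × OnePoint X)} (hU : U ∈ 𝓤 (OnePoint X)) :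
    ∀ᶠ t in 𝓝 (1 : T), ∀ x : X, ((x : OnePoint X), ((x <• t : X) : OnePoint X)) ∈ U := by
  have key := isCompact_univ.eventually_forall_of_forall_eventually (x₀ := (1 : T))
    (K := (univ : Set (OnePoint X)))
    (P := fun t z ↦ ∀ x : X, z = x → ((x : OnePoint X), ((x <• t : X) : OnePoint X)) ∈ U) ?_
  · exact key.mono fun t ht x ↦ ht x trivial x rfl
  intro z _
  obtain ⟨O, hO, hz, hOU⟩ := exists_isOpen_small u hu hU z
  induction z using OnePoint.rec with
  | coe x₀ =>
    have hcont : Continuous fun p : T × X ↦ ((p.2 <• p.1 : X) : OnePoint X) :=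
      OnePoint.continuous_coe.comp (hact.comp continuous_swap)
    have h : ∀ᶠ p : T × X in 𝓝 (1, x₀), (p.2 : OnePoint X) ∈ O ∧
        ((p.2 <• p.1 : X) : OnePoint X) ∈ O := by
      refine .and ?_ (hcont.continuousAt.eventually_mem (hO.mem_nhds (by simpa using hz)))
      exact (OnePoint.continuous_coe.comp continuous_snd).continuousAt.eventually_mem
        (hO.mem_nhds hz)
    rw [nhds_prod_eq, OnePoint.nhds_coe_eq, ← Filter.map_id (f := 𝓝 (1 : T)),
      Filter.prod_map_map_eq,
      eventually_map, ← nhds_prod_eq]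
    filter_upwards [h] with p hp x hx
    obtain rfl : p.2 = x := OnePoint.coe_injective hx
    exact hOU _ hp.1 _ hp.2
  | infty =>
    have hK := ((OnePoint.isOpen_iff_of_mem hz).1 hO).2
    let K : Set X := ((↑) ⁻¹' O)ᶜ
    have hKT : IsCompact ((fun p : X × T ↦ p.1 <• p.2) '' (K ×ˢ univ)) :=
      (hK.prod isCompact_univ).image hact
    have hnhds : ((↑) '' ((fun p : X × T ↦ p.1 <• p.2) '' (K ×ˢ univ)))ᶜ ∈
        𝓝 (OnePoint.infty : OnePoint X) :=
      (OnePoint.isOpen_compl_image_coe.2 ⟨hKT.isClosed, hKT⟩).mem_nhds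
        OnePoint.infty_notMem_image_coe
    filter_upwards [continuous_snd.continuousAt.eventually_mem (x := ((1 : T), OnePoint.infty)) hnhds]
      with p hp x hx
    have hmem (t : T) : ((x <• t : X) : OnePoint X) ∈ O := by
      by_contra hxt
      refine hp ⟨x, ⟨(x <• t, t⁻¹), ⟨hxt, trivial⟩, ?_⟩, hx.symm⟩
      simp [smul_smul]
    exact hOU _ (by simpa using hmem 1) _ (hmem p.1)

theorem coverEntropy_orbit_le {X T : Type*} [TopologicalSpace X] [T2Space X]
    [LocallyCompactSpace X] [Group T] [TopologicalSpace T] [IsTopologicalGroup T] [CompactSpace T]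
    [MulAction Tᵐᵒᵖ X] (hact : Continuous fun p : X × T ↦ p.1 <• p.2)
    (u : UniformSpace (OnePoint X))
    (hu : u.toTopologicalSpace = OnePoint.instTopologicalSpace) {φ : X → X} {τ : T → T}
    (hτ : ∀ (x : X) (t : T), φ (x <• t) = φ x <• τ t) (x : X) :
    @Dynamics.coverEntropy X (u.comap (↑)) φ (range fun t : T ↦ x <• t) ≤ topEntropy τ := by
  classical
  let uT : UniformSpace T := IsTopologicalGroup.leftUniformSpace T
  refine le_trans ?_ (coverEntropy_le_topEntropy uT τ
    fun V hV ↦ exists_isAdmissibleCover_small uT rfl hV)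
  refine iSup₂_le fun U ⟨D, hD, hDU⟩ ↦ ?_
  have hev := eventually_forall_smul_close (T := T) hact u hu hD
  let V : Set (T × T) :=
    {p | ∀ y : X, ((y : OnePoint X), ((y <• (p.1⁻¹ * p.2) : X) : OnePoint X)) ∈ D}
  have hV : V ∈ 𝓤 T := preimage_mem_comap hev
  have hiter (n : ℕ) (t : T) : φ^[n] (x <• t) = φ^[n] x <• τ^[n] t := by
    induction n with
    | zero => rfl
    | succ n ih => simp only [Function.iterate_succ_apply', ih, hτ]
  refine le_trans (ExpGrowth.expGrowthSup_monotone fun n ↦ ENat.toENNReal_mono ?_)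
    (Dynamics.coverEntropyEntourage_le_coverEntropy τ univ hV)
  refine le_iInf₂ fun E hE ↦ ?_
  have hcov : Dynamics.IsDynCoverOf φ (range fun t : T ↦ x <• t) U n
      (E.image fun t ↦ x <• t : Finset X) := by
    rw [isDynCoverOf_iff]
    rintro _ ⟨t, rfl⟩
    obtain ⟨s, hs, hts⟩ := isDynCoverOf_iff.1 hE t trivial
    refine ⟨x <• s, by simpa using ⟨s, hs, rfl⟩, fun k hk ↦ hDU ?_⟩
    -- At this point, acting by `(τ^[k] t)⁻¹ * τ^[k] s` gives `φ^[k] x <• τ^[k] s`.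
    have h := hts k hk (φ^[k] x <• τ^[k] t)
    rw [hiter, hiter]
    simpa [smul_smul] using h
  exact hcov.coverMincard_le_card.trans (by exact_mod_cast Finset.card_image_le)

end Extensions

end LocallyCompactEntropy

theorem mainTheorem6 {X Y : Type*}
    [TopologicalSpace X] [LocallyCompactSpace X] [TopologicalSpace.MetrizableSpace X]
    [TopologicalSpace Y] [LocallyCompactSpace Y] [TopologicalSpace.MetrizableSpace Y]
    (π : X → Y) (φ : X → X) (ϕ : Y → Y)
    (hπ : IsProperMap π) (hφ : IsProperMap φ) (hϕ : IsProperMap ϕ)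
    (hcomm : π ∘ φ = ϕ ∘ π) :
    (∀ d : MetricSpace (OnePoint X),
      d.toPseudoMetricSpace.toUniformSpace.toTopologicalSpace =
          (OnePoint.instTopologicalSpace : TopologicalSpace (OnePoint X)) →
        LocallyCompactEntropy.topEntropy φ ≤ LocallyCompactEntropy.topEntropy ϕ +
          ⨆ y : Y, LocallyCompactEntropy.metricEntropy
            (LocallyCompactEntropy.inducedDist d) φ (π ⁻¹' {y})) ∧
    (∀ (T : Type*) [Group T] [TopologicalSpace T] [IsTopologicalGroup T] [CompactSpace T]
        [MulAction Tᵐᵒᵖ X] (τ : T → T),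
      LocallyCompactEntropy.IsPrincipalBundle T π →
      (∀ (x : X) (t : T), φ (x <• t) = φ x <• τ t) →
        LocallyCompactEntropy.topEntropy φ ≤
          LocallyCompactEntropy.topEntropy ϕ + LocallyCompactEntropy.topEntropy τ) := by
  have hsemi : Function.Semiconj π φ ϕ := congrFun hcomm
  -- The uniformity of `inducedDist d` is by definition the one pulled back from `OnePoint X`.
  refine ⟨fun d hd ↦ LocallyCompactEntropy.topEntropy_le_add_iSup_fibre hπ hφ hsemi
    d.toPseudoMetricSpace.toUniformSpace hd, fun T _ _ _ _ _ τ hbundle hτ ↦ ?_⟩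
  let u : UniformSpace (OnePoint X) := uniformSpaceOfCompactR1
  refine (LocallyCompactEntropy.topEntropy_le_add_iSup_fibre hπ hφ hsemi u rfl).trans
    (add_le_add le_rfl (iSup_le fun y ↦ ?_))
  rcases (π ⁻¹' {y}).eq_empty_or_nonempty with hy | ⟨x, rfl⟩
  · rw [hy, @Dynamics.coverEntropy_empty X _ (u.comap (↑))]
    exact bot_le
  · have hfib : π ⁻¹' {π x} = range fun t : T ↦ x <• t := by
      ext x'
      simpa [eq_comm] using hbundle.fibre_eq_orbit x x'
    rw [hfib]
    exact LocallyCompactEntropy.coverEntropy_orbit_le hbundle.continuous_action u rfl hτ x
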